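/- Let $d,N$ be natural numbers with $N\ge 2$ and let $S=\{S_1,\dots,S_N\}$ be similarity maps of $\mathbb R^d$ with scaling ratios $r_1,\dots,r_N\in(0,1)$, that is, $\|S_ix-S_iy\|=r_i\|x-y\|$ for all $x,y$. Let $F$ be the attractor of $S$, i.e. the unique nonempty compact set with $F=\bigcup_{i=1}^N S_iF$. Write $\lambda_d$ for Lebesgue measure, $d(x,F)$ for the Euclidean distance from $x$ to $F$, and $F_\varepsilon=\{x\in\mathbb R^d: d(x,F)\le\varepsilon\}$. Assume that $S$ is of lattice type: there is $r>0$ such that every $r_i$ is an integer power of $r$. A *feasible open set* is a nonempty open set $O\subseteq\mathbb R^d$ with $S_iO\subseteq O$ for all $i$ and $S_iO\cap S_jO=\emptyset$ for $i\ne j$; assume the open set condition, i.e. that a feasible open set exists. Assume that the Minkowski dimension $$D=\dim_{\mathcal M}F=\inf\{\alpha\ge 0:\ \lim_{\varepsilon\to0^+}\varepsilon^{\alpha-d}\lambda_d(F_\varepsilon)=0\}$$ is not an integer. Assume further that there is a feasible open set $O$ with the following properties. 1. ($O$ is strong.) $O\cap F\neq\emptyset$. 2. (Projection condition.) $S_iO\subseteq\overline{\pi_F^{-1}(S_iF)}$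 for $i=1,\dots,N$, where $\pi_F$ is the metric projection onto $F$, defined on the set of points $x$ that have a unique nearest point $\pi_F(x)$ in $F$. 3. ($F$ is pluriphase with respect to $\Gamma=\Gamma(O):=O\setminus\bigcup_{i=1}^N S_iO$.) The number $g:=\sup\{d(x,F):x\in\Gamma\}$ is finite, and there are $M\ge1$, points $0=a_0<a_1<\dots<a_M=g$ and constants $\kappa_{m,k}\in\mathbb R$ ($1\le m\le M$, $0\le k\le d$) such that, for all $\varepsilon>0$, $$\lambda_d(F_\varepsilon\cap\Gamma)=\sum_{m=1}^M\mathbf 1_{(a_{m-1},a_m]}(\varepsilon)\sum_{k=0}^d\kappa_{m,k}\,\varepsilon^{d-k}+\mathbf 1_{(g,\infty)}(\varepsilon)\,\lambda_d(\Gamma).$$ Then $F$ is not Minkowski measurable: there is no $\alpha\in[0,d]$ for which the limit $\lim_{\varepsilon\to0^+}\varepsilon^{\alpha-d}\lambda_d(F_\varepsilon)$ exists and is positive and finite. -/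

import Mathlib

open Set Filter Topology MeasureTheory

noncomputable section

/-- `HasMinkowskiContent A α c` says that the `α`-dimensional Minkowski content of `A ⊆ ℝ^d`,
the limit of `ε^(α - d) * λ_d(A_ε)` as `ε → 0+`, exists in `[0, ∞]` and equals `c`.
Here `A_ε = Metric.cthickening ε A` is the closed `ε`-parallel set of `A`. -/
def HasMinkowskiContent {d : ℕ} (A : Set (EuclideanSpace ℝ (Fin d))) (α : ℝ) (c : ENNReal) :
    Prop :=
  Tendsto (fun ε : ℝ => ENNReal.ofReal (ε ^ (α - (d : ℝ))) * volume (Metric.cthickening ε A))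
    (𝓝[>] (0 : ℝ)) (𝓝 c)

/-- `A` is Minkowski measurable: for some `α ∈ [0, d]` the `α`-dimensional Minkowski content
exists and is neither `0` nor `∞`. -/
def IsMinkowskiMeasurable {d : ℕ} (A : Set (EuclideanSpace ℝ (Fin d))) : Prop :=
  ∃ α : ℝ, 0 ≤ α ∧ α ≤ (d : ℝ) ∧ ∃ c : ENNReal, c ≠ 0 ∧ c ≠ ⊤ ∧ HasMinkowskiContent A α c

/-- The Minkowski dimension of a bounded set, as the critical exponent of the Minkowski content:
the infimum of all `α ≥ 0` with `ε^(α - d) * λ_d(A_ε) → 0`. All `α > d` belong to this set when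
`A` is bounded, so the infimum is a genuine one. If the `α`-dimensional Minkowski content of `A`
is positive and finite, the value is `α`; in general it is the upper box dimension. -/
def minkowskiDim {d : ℕ} (A : Set (EuclideanSpace ℝ (Fin d))) : ℝ :=
  sInf {α : ℝ | 0 ≤ α ∧ HasMinkowskiContent A α 0}

/-- `y` is the metric projection of `x` onto `A`: it is the unique nearest neighbour of `x`
in `A`. -/
def IsMetricProjection {d : ℕ} (A : Set (EuclideanSpace ℝ (Fin d)))
    (x y : EuclideanSpace ℝ (Fin d)) : Prop :=
  y ∈ A ∧ ∀ z ∈ A, z ≠ y → dist x y < dist x z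

/-- A self-similar system: `N` contractive similarities of `ℝ^d`, with their scaling ratios. -/
structure SelfSimilarSystem (d N : ℕ) where
  /-- the similarity maps -/
  map : Fin N → EuclideanSpace ℝ (Fin d) → EuclideanSpace ℝ (Fin d)
  /-- the scaling ratios -/
  ratio : Fin N → ℝ
  ratio_pos : ∀ i, 0 < ratio i
  ratio_lt_one : ∀ i, ratio i < 1
  dist_map : ∀ i x y, dist (map i x) (map i y) = ratio i * dist x y

namespace SelfSimilarSystem

variable {d N : ℕ}

/-- The Hutchinson operator `A ↦ ⋃ i, S_i(A)`. -/
def union (S : SelfSimilarSystem d N) (A : Set (EuclideanSpace ℝ (Fin d))) :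
    Set (EuclideanSpace ℝ (Fin d)) :=
  ⋃ i, S.map i '' A

/-- `F` is the attractor (the self-similar set) of the system. -/
def IsAttractor (S : SelfSimilarSystem d N) (F : Set (EuclideanSpace ℝ (Fin d))) : Prop :=
  IsCompact F ∧ F.Nonempty ∧ F = S.union F

/-- Lattice type: all scaling ratios are integer powers of a single `r > 0`. -/
def IsLattice (S : SelfSimilarSystem d N) : Prop :=
  ∃ r : ℝ, 0 < r ∧ ∀ i, ∃ k : ℤ, S.ratio i = r ^ k

/-- `O` is a feasible open set. -/
def IsFeasible (S : SelfSimilarSystem d N) (O : Set (EuclideanSpace ℝ (Fin d))) : Prop :=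
  IsOpen O ∧ O.Nonempty ∧ (∀ i, S.map i '' O ⊆ O) ∧
    ∀ i j, i ≠ j → S.map i '' O ∩ S.map j '' O = ∅

/-- The open set condition. -/
def OpenSetCondition (S : SelfSimilarSystem d N) : Prop :=
  ∃ O, S.IsFeasible O

/-- `O` is a strong feasible open set with respect to the attractor `F`. -/
def IsStrongFeasible (S : SelfSimilarSystem d N) (F O : Set (EuclideanSpace ℝ (Fin d))) : Prop :=
  S.IsFeasible O ∧ (O ∩ F).Nonempty

/-- The projection condition: `S_i(O)` lies in the closure of `π_F⁻¹(S_i(F))` for every `i`,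
where `π_F` is the metric projection onto `F`. -/
def ProjectionCondition (S : SelfSimilarSystem d N) (F O : Set (EuclideanSpace ℝ (Fin d))) :
    Prop :=
  ∀ i, S.map i '' O ⊆ closure {x | ∃ y ∈ S.map i '' F, IsMetricProjection F x y}

/-- The set `Γ(O) = O \ ⋃ i, S_i(O)`. -/
def Gamma (S : SelfSimilarSystem d N) (O : Set (EuclideanSpace ℝ (Fin d))) :
    Set (EuclideanSpace ℝ (Fin d)) :=
  O \ S.union O

/-- `F` is pluriphase with respect to `Γ = Γ(O)`: there are `0 = a_0 < a_1 < ... < a_M = g`,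
`M ≥ 1`, where `g` is the supremum (in `ℝ`) of the distances `d(x, F)`, `x ∈ Γ`, such that
`ε ↦ λ_d(F_ε ∩ Γ)` is a polynomial of degree at most `d` on each interval `(a_(m-1), a_m]` and
equals `λ_d(Γ)` on `(g, ∞)`. (Asking `M` to be minimal changes nothing in the existence.) -/
def IsPluriphase (S : SelfSimilarSystem d N) (F O : Set (EuclideanSpace ℝ (Fin d))) : Prop :=
  ∃ (M : ℕ) (a : Fin (M + 1) → ℝ) (κ : Fin M → Fin (d + 1) → ℝ),
    1 ≤ M ∧ a 0 = 0 ∧ StrictMono a ∧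
    IsLUB ((fun x => Metric.infDist x F) '' S.Gamma O) (a (Fin.last M)) ∧
    (∀ m : Fin M, ∀ ε ∈ Ioc (a m.castSucc) (a m.succ),
      volume.real (Metric.cthickening ε F ∩ S.Gamma O)
        = ∑ k : Fin (d + 1), κ m k * ε ^ (d - (k : ℕ))) ∧
    ∀ ε, a (Fin.last M) < ε →
      volume.real (Metric.cthickening ε F ∩ S.Gamma O) = volume.real (S.Gamma O)

end SelfSimilarSystem

end

/-!
Suppose that the `α`-dimensional Minkowski content of `F` is positive and finite. Then `α` is the
Minkowski dimension of `F`, hence not an integer. Write `V(ε) = ε ^ (α - d) * λ_d(F_ε)`,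
`f(ε) = ε ^ (α - d) * λ_d(F_ε ∩ O)` and `γ(ε) = ε ^ (α - d) * λ_d(F_ε ∩ Γ)`.

* The projection condition turns `O = Γ ∪ ⋃ i, S_i(O)` into the renewal equation
  `f(ε) = ∑ i, p_i f(ε / r_i) + γ(ε)` with `p_i = r_i ^ α` (`scaledVolume_renewal`), and the
  existence of the content forces `∑ i, p_i = 1` (`sum_ratio_rpow_eq_one`).
* The part of `F_ε` outside `O` is negligible: some cylinder of `F` lies well inside `O`, so the
  limit superior of the normalised volume outside `O` is at most a fixed multiple, smaller than
  one, of itself (`tendsto_scaledVolume_compl`). Hence `f` has the same positive limit `c` at `0`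
  as `V`.
* With `r_i = r ^ k_i`, `0 < r < 1`, the function
  `Φ(t) = ∑ i, p_i ∑ j ∈ {1, …, k_i}, f(t / r ^ j)` satisfies `Φ(r t) - Φ(t) = γ(t)`, and it tends
  to `L = c * ∑ i, p_i k_i > 0` at `0`. In particular `f` is bounded by `L`; together with the
  finiteness of `g` this implies `O ⊆ F_g` (`infDist_le_of_scaledVolume_le`), and so
  `Φ(t) → 0` as `t → ∞`.
* For a suitable `x > 1` no breakpoint `a_m` separates two points of an interval `r ^ n * (1, x]`,
  `n ∈ ℤ`. Therefore on each `r ^ n * (1, x]` the function `γ` is a linear combination of the powers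
  `ε ^ (α - k)`, `0 ≤ k ≤ d`. A difference operator along a geometric progression in `(1, x]` kills
  all these powers, but not the constants, because `α` is not an integer
  (`exists_annihilator_rpow`). Applied to `t ↦ Φ(r ^ n * t)` it gives a number that does not depend
  on `n ∈ ℤ`, that tends to a nonzero multiple of `L` as `n → ∞` and to `0` as `n → -∞`: a
  contradiction.
-/

/-! ### Similarities of Euclidean space -/

lemma similarity_eq_smul_affine {d : ℕ} {T : EuclideanSpace ℝ (Fin d) → EuclideanSpace ℝ (Fin d)}
    {ρ : ℝ} (hρ : 0 < ρ) (hT : ∀ x y, dist (T x) (T y) = ρ * dist x y) :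
    ∃ (L : EuclideanSpace ℝ (Fin d) ≃ₗᵢ[ℝ] EuclideanSpace ℝ (Fin d))
      (b : EuclideanSpace ℝ (Fin d)), ∀ x, T x = ρ • L x + b := by
  have hφ : Isometry (fun x => ρ⁻¹ • T x) := by
    refine Isometry.of_dist_eq fun x y => ?_
    rw [dist_smul₀, hT, Real.norm_of_nonneg (by positivity)]
    field_simp
  let A := hφ.affineIsometryOfStrictConvexSpace
  refine ⟨A.linearIsometry.toLinearIsometryEquiv rfl, T 0, fun x => ?_⟩
  have h1 : A.linearIsometry x = ρ⁻¹ • T x - ρ⁻¹ • T 0 := by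
    have := A.map_vsub x 0
    simpa [A] using this
  simp only [LinearIsometry.toLinearIsometryEquiv_apply] 
  rw [h1, smul_sub, smul_inv_smul₀ hρ.ne', smul_inv_smul₀ hρ.ne']
  simp

lemma similarity_surjective {d : ℕ} {T : EuclideanSpace ℝ (Fin d) → EuclideanSpace ℝ (Fin d)}
    {ρ : ℝ} (hρ : 0 < ρ) (hT : ∀ x y, dist (T x) (T y) = ρ * dist x y) :
    Function.Surjective T := by
  obtain ⟨L, b, h⟩ := similarity_eq_smul_affine hρ hT
  intro y
  refine ⟨L.symm (ρ⁻¹ • (y - b)), ?_⟩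
  rw [h, L.apply_symm_apply, smul_inv_smul₀ hρ.ne', sub_add_cancel]

lemma similarity_injective {X Y : Type*} [MetricSpace X] [MetricSpace Y] {T : X → Y} {ρ : ℝ}
    (hρ : 0 < ρ) (hT : ∀ x y, dist (T x) (T y) = ρ * dist x y) : Function.Injective T := by
  intro x y hxy
  have := hT x y
  rw [hxy, dist_self] at this
  exact dist_eq_zero.1 ((mul_eq_zero.1 this.symm).resolve_left hρ.ne')

lemma image_ball_similarity {d : ℕ} {T : EuclideanSpace ℝ (Fin d) → EuclideanSpace ℝ (Fin d)}
    {ρ : ℝ} (hρ : 0 < ρ) (hT : ∀ x y, dist (T x) (T y) = ρ * dist x y)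
    (x : EuclideanSpace ℝ (Fin d)) (δ : ℝ) :
    T '' Metric.ball x δ = Metric.ball (T x) (ρ * δ) := by
  ext y
  obtain ⟨y, rfl⟩ := similarity_surjective hρ hT y
  rw [(similarity_injective hρ hT).mem_set_image, Metric.mem_ball, Metric.mem_ball, hT,
    mul_lt_mul_iff_right₀ hρ]

lemma isOpen_image_similarity {d : ℕ} {T : EuclideanSpace ℝ (Fin d) → EuclideanSpace ℝ (Fin d)}
    {ρ : ℝ} (hρ : 0 < ρ) (hT : ∀ x y, dist (T x) (T y) = ρ * dist x y)
    {A : Set (EuclideanSpace ℝ (Fin d))} (hA : IsOpen A) : IsOpen (T '' A) := by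
  rw [Metric.isOpen_iff]
  rintro _ ⟨x, hx, rfl⟩
  obtain ⟨δ, hδ, h⟩ := Metric.isOpen_iff.1 hA x hx
  exact ⟨ρ * δ, by positivity, by rw [← image_ball_similarity hρ hT]; exact image_mono h⟩

open scoped Pointwise in
lemma volume_real_image_similarity {d : ℕ}
    {T : EuclideanSpace ℝ (Fin d) → EuclideanSpace ℝ (Fin d)} {ρ : ℝ} (hρ : 0 < ρ)
    (hT : ∀ x y, dist (T x) (T y) = ρ * dist x y) (A : Set (EuclideanSpace ℝ (Fin d))) :
    volume.real (T '' A) = ρ ^ d * volume.real A := by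
  obtain ⟨L, b, h⟩ := similarity_eq_smul_affine hρ hT
  have h1 : T '' A = (fun y => y + b) '' (ρ • (L '' A)) := by
    ext y
    simp only [mem_image, ← image_smul, exists_exists_and_eq_and, h]
  have h2 : volume (L '' A) = volume A := by
    have := L.symm.measurePreserving.measure_preimage_emb
      L.symm.toHomeomorph.measurableEmbedding A
    rw [← this]
    congr 1
    exact L.toEquiv.image_eq_preimage_symm A
  rw [h1, measureReal_def, image_add_right, measure_preimage_add_right,
    Measure.addHaar_smul_of_nonneg _ hρ.le, h2, ENNReal.toReal_mul, measureReal_def,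
    finrank_euclideanSpace, Fintype.card_fin, ENNReal.toReal_ofReal (by positivity)]

lemma infDist_image_similarity {X Y : Type*} [MetricSpace X] [MetricSpace Y] {T : X → Y} {ρ : ℝ}
    (hρ : 0 < ρ) (hT : ∀ x y, dist (T x) (T y) = ρ * dist x y) {A : Set X} (hA : A.Nonempty)
    (x : X) : Metric.infDist (T x) (T '' A) = ρ * Metric.infDist x A := by
  apply le_antisymm
  · rw [← div_le_iff₀' hρ, Metric.le_infDist hA]
    intro y hy
    rw [div_le_iff₀' hρ, ← hT]
    exact Metric.infDist_le_dist_of_mem (mem_image_of_mem T hy)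
  · rw [Metric.le_infDist (hA.image T)]
    rintro _ ⟨y, hy, rfl⟩
    rw [hT]
    exact mul_le_mul_of_nonneg_left (Metric.infDist_le_dist_of_mem hy) hρ.le

lemma mem_cthickening_iff_infDist {X : Type*} [MetricSpace X] {A : Set X} (hA : A.Nonempty)
    {ε : ℝ} (hε : 0 ≤ ε) (x : X) : x ∈ Metric.cthickening ε A ↔ Metric.infDist x A ≤ ε := by
  rw [Metric.mem_cthickening_iff, Metric.infDist,
    ENNReal.le_ofReal_iff_toReal_le (Metric.infEDist_ne_top hA) hε]

lemma cthickening_image_similarity {d : ℕ}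
    {T : EuclideanSpace ℝ (Fin d) → EuclideanSpace ℝ (Fin d)} {ρ : ℝ} (hρ : 0 < ρ)
    (hT : ∀ x y, dist (T x) (T y) = ρ * dist x y) {A : Set (EuclideanSpace ℝ (Fin d))}
    (hA : A.Nonempty) {ε : ℝ} (hε : 0 ≤ ε) :
    Metric.cthickening ε (T '' A) = T '' Metric.cthickening (ε / ρ) A := by
  ext y
  obtain ⟨y, rfl⟩ := similarity_surjective hρ hT y
  rw [(similarity_injective hρ hT).mem_set_image, mem_cthickening_iff_infDist (hA.image T) hε,
    mem_cthickening_iff_infDist hA (by positivity), infDist_image_similarity hρ hT hA,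
    le_div_iff₀' hρ]

/-! ### Normalised parallel volumes -/

/-- The volume of the part in `A` of the closed parallel set `F_ε`, normalised as in the
`α`-dimensional Minkowski content: `ε ^ (α - d) * λ_d(F_ε ∩ A)`. -/
noncomputable def scaledVolume {d : ℕ} (α : ℝ) (F A : Set (EuclideanSpace ℝ (Fin d))) (ε : ℝ) : ℝ :=
  ε ^ (α - (d : ℝ)) * volume.real (Metric.cthickening ε F ∩ A)

section scaledVolume

variable {d : ℕ} {α : ℝ} {F A B : Set (EuclideanSpace ℝ (Fin d))}

lemma scaledVolume_nonneg {ε : ℝ} (hε : 0 ≤ ε) : 0 ≤ scaledVolume α F A ε :=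
  mul_nonneg (Real.rpow_nonneg hε _) measureReal_nonneg

/-- Normalised parallel volumes of a similar copy: the normalisation turns the factor `ρ ^ d` of
the volume into `ρ ^ α`. -/
lemma scaledVolume_image {T : EuclideanSpace ℝ (Fin d) → EuclideanSpace ℝ (Fin d)} {ρ : ℝ}
    (hρ : 0 < ρ) (hT : ∀ x y, dist (T x) (T y) = ρ * dist x y) (hF : F.Nonempty) {ε : ℝ}
    (hε : 0 < ε) :
    scaledVolume α (T '' F) (T '' A) ε = ρ ^ α * scaledVolume α F A (ε / ρ) := by
  rw [scaledVolume, scaledVolume, cthickening_image_similarity hρ hT hF hε.le,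
    ← image_inter (similarity_injective hρ hT), volume_real_image_similarity hρ hT,
    Real.div_rpow hε.le hρ.le, Real.rpow_sub hρ, Real.rpow_natCast]
  have := Real.rpow_pos_of_pos hρ α
  field_simp

lemma volume_cthickening_inter_ne_top (hF : IsCompact F) (ε : ℝ) :
    volume (Metric.cthickening ε F ∩ A) ≠ ⊤ :=
  ((measure_mono inter_subset_left).trans_lt hF.isBounded.cthickening.measure_lt_top).ne

lemma scaledVolume_mono (hF : IsCompact F) {ε : ℝ} (hε : 0 ≤ ε) (hAB : A ⊆ B) :
    scaledVolume α F A ε ≤ scaledVolume α F B ε :=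
  mul_le_mul_of_nonneg_left
    (measureReal_mono (inter_subset_inter_right _ hAB) (volume_cthickening_inter_ne_top hF ε))
    (Real.rpow_nonneg hε _)

lemma scaledVolume_add_compl (hF : IsCompact F) (hA : MeasurableSet A) (ε : ℝ) :
    scaledVolume α F A ε + scaledVolume α F Aᶜ ε = scaledVolume α F univ ε := by
  rw [scaledVolume, scaledVolume, scaledVolume, ← mul_add, inter_univ, ← sdiff_eq,
    measureReal_inter_add_sdiff hA (hF.isBounded.cthickening.measure_lt_top).ne]

lemma tendsto_div_nhdsGT_zero {ρ : ℝ} (hρ : 0 < ρ) :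
    Tendsto (fun ε : ℝ => ε / ρ) (𝓝[>] 0) (𝓝[>] 0) := by
  refine tendsto_nhdsWithin_iff.2 ⟨?_, ?_⟩
  · have : Tendsto (fun ε : ℝ => ε / ρ) (𝓝 0) (𝓝 (0 / ρ)) := tendsto_id.div_const ρ
    rw [zero_div] at this
    exact this.mono_left nhdsWithin_le_nhds
  · filter_upwards [self_mem_nhdsWithin] with ε hε
    exact div_pos hε hρ

end scaledVolume

/-! ### Minkowski content and dimension -/

/-- A positive limit of the normalised parallel volume for the exponent `α` forces the Minkowski
dimension to be `α`. -/
lemma minkowskiDim_eq_of_hasMinkowskiContent {d : ℕ} {A : Set (EuclideanSpace ℝ (Fin d))}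
    {α : ℝ} (hα : 0 ≤ α) {c : ENNReal} (hc : c ≠ 0) (hc' : c ≠ ⊤)
    (h : HasMinkowskiContent A α c) : minkowskiDim A = α := by
  have key : ∀ β : ℝ, (fun ε : ℝ => ENNReal.ofReal (ε ^ (β - (d : ℝ))) *
      volume (Metric.cthickening ε A)) =ᶠ[𝓝[>] 0]
      fun ε => ENNReal.ofReal (ε ^ (β - α)) * (ENNReal.ofReal (ε ^ (α - (d : ℝ))) *
        volume (Metric.cthickening ε A)) := by
    intro β
    filter_upwards [self_mem_nhdsWithin] with ε hε
    have hε : 0 < ε := hε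
    rw [← mul_assoc, ← ENNReal.ofReal_mul (by positivity), ← Real.rpow_add hε]
    congr 3
    ring
  have hset : {β : ℝ | 0 ≤ β ∧ HasMinkowskiContent A β 0} = Ioi α := by
    ext β
    simp only [mem_ofPred_eq, mem_Ioi]
    constructor
    · rintro ⟨-, hβ⟩
      by_contra! hle
      rcases hle.eq_or_lt with rfl | hlt
      · exact hc (tendsto_nhds_unique h hβ)
      · have h1 : Tendsto (fun ε : ℝ => ENNReal.ofReal (ε ^ (β - α))) (𝓝[>] 0) (𝓝 ⊤) :=
          ENNReal.tendsto_ofReal_nhds_top.2 (tendsto_rpow_neg_nhdsGT_zero (by linarith))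
        have h2 := ENNReal.Tendsto.mul h1 (Or.inl ENNReal.top_ne_zero) h (Or.inl hc)
        rw [ENNReal.top_mul hc] at h2
        exact ENNReal.top_ne_zero (tendsto_nhds_unique (h2.congr' (key β).symm) hβ)
    · intro hlt
      refine ⟨by linarith, ?_⟩
      have h1 : Tendsto (fun ε : ℝ => ENNReal.ofReal (ε ^ (β - α))) (𝓝[>] 0) (𝓝 0) := by
        have : Tendsto (fun ε : ℝ => ε ^ (β - α)) (𝓝[>] 0) (𝓝 0) := by
          have h0 := (Real.continuousAt_rpow_const (0 : ℝ) (β - α) (Or.inr (by linarith))).tendsto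
          rw [Real.zero_rpow (by linarith)] at h0
          exact h0.mono_left nhdsWithin_le_nhds
        simpa using ENNReal.tendsto_ofReal this
      have h2 := ENNReal.Tendsto.mul h1 (Or.inr hc') h (Or.inr ENNReal.zero_ne_top)
      rw [zero_mul] at h2
      exact h2.congr' (key β).symm
  rw [minkowskiDim, hset, csInf_Ioi]

lemma tendsto_scaledVolume_of_hasMinkowskiContent {d : ℕ} {A : Set (EuclideanSpace ℝ (Fin d))}
    {α : ℝ} {c : ENNReal} (hc' : c ≠ ⊤) (h : HasMinkowskiContent A α c) :
    Tendsto (scaledVolume α A univ) (𝓝[>] 0) (𝓝 c.toReal) := by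
  refine ((ENNReal.tendsto_toReal hc').comp h).congr' ?_
  filter_upwards [self_mem_nhdsWithin] with ε hε
  have hε : 0 < ε := hε
  rw [Function.comp_apply, ENNReal.toReal_mul, ENNReal.toReal_ofReal (by positivity),
    scaledVolume, inter_univ, measureReal_def]

lemma scaledVolume_iUnion_le {d : ℕ} {ι : Type*} [Fintype ι] {α : ℝ}
    {G : ι → Set (EuclideanSpace ℝ (Fin d))} (hG : ∀ i, IsCompact (G i))
    (B : Set (EuclideanSpace ℝ (Fin d))) {ε : ℝ} (hε : 0 ≤ ε) :
    scaledVolume α (⋃ i, G i) B ε ≤ ∑ i, scaledVolume α (G i) B ε := by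
  simp only [scaledVolume]
  rw [← Finset.mul_sum]
  refine mul_le_mul_of_nonneg_left ?_ (Real.rpow_nonneg hε _)
  have hsub : Metric.cthickening ε (⋃ i, G i) ∩ B ⊆ ⋃ i, Metric.cthickening ε (G i) ∩ B := by
    rintro x ⟨hx, hxB⟩
    rw [(isCompact_iUnion hG).cthickening_eq_biUnion_closedBall hε] at hx
    simp only [mem_iUnion, exists_prop] at hx
    obtain ⟨y, ⟨i, hy⟩, hxy⟩ := hx
    refine mem_iUnion.2 ⟨i, ?_, hxB⟩
    exact Metric.mem_cthickening_of_dist_le x y ε _ hy hxy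
  refine (measureReal_mono hsub ?_).trans (measureReal_iUnion_fintype_le _)
  exact ((measure_iUnion_le _).trans_lt (by
    rw [tsum_fintype]
    exact ENNReal.sum_lt_top.2 fun i _ =>
      (volume_cthickening_inter_ne_top (hG i) ε).lt_top)).ne

/-! ### The renewal equation -/

namespace SelfSimilarSystem

variable {d N : ℕ} {S : SelfSimilarSystem d N} {F O : Set (EuclideanSpace ℝ (Fin d))} {α : ℝ}

lemma exists_ratio_le (hN : 2 ≤ N) (S : SelfSimilarSystem d N) :
    ∃ R, 0 < R ∧ R < 1 ∧ ∀ i, S.ratio i ≤ R := by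
  have : Nonempty (Fin N) := ⟨⟨0, by omega⟩⟩
  obtain ⟨i, hi⟩ := Finite.exists_max S.ratio
  exact ⟨S.ratio i, S.ratio_pos i, S.ratio_lt_one i, hi⟩

lemma exists_le_ratio (hN : 2 ≤ N) (S : SelfSimilarSystem d N) :
    ∃ q, 0 < q ∧ ∀ i, q ≤ S.ratio i := by
  have : Nonempty (Fin N) := ⟨⟨0, by omega⟩⟩
  obtain ⟨i, hi⟩ := Finite.exists_min S.ratio
  exact ⟨S.ratio i, S.ratio_pos i, hi⟩

lemma IsAttractor.image_subset (hF : S.IsAttractor F) (i : Fin N) : S.map i '' F ⊆ F := by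
  conv_rhs => rw [hF.2.2]
  exact subset_iUnion (fun i => S.map i '' F) i

lemma isCompact_image {T : EuclideanSpace ℝ (Fin d) → EuclideanSpace ℝ (Fin d)}
    {ρ : ℝ} (hρ : 0 < ρ) (hT : ∀ x y, dist (T x) (T y) = ρ * dist x y) (hF : IsCompact F) :
    IsCompact (T '' F) :=
  hF.image (LipschitzWith.of_dist_le_mul (K := ⟨ρ, hρ.le⟩) fun x y => (hT x y).le).continuous

/-- Under the projection condition the distance to `F` is, on `S_i(O)`, the distance to
`S_i(F)`: this is clear on `π_F⁻¹(S_i(F))`, and both distances are continuous. -/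
lemma ProjectionCondition.infDist_eq (hP : S.ProjectionCondition F O) (hF : S.IsAttractor F)
    {i : Fin N} {x : EuclideanSpace ℝ (Fin d)} (hx : x ∈ S.map i '' O) :
    Metric.infDist x F = Metric.infDist x (S.map i '' F) := by
  have hcl : IsClosed {x | Metric.infDist x F = Metric.infDist x (S.map i '' F)} :=
    isClosed_eq (Metric.continuous_infDist_pt _) (Metric.continuous_infDist_pt _)
  refine hcl.closure_subset_iff.2 ?_ (hP i hx)
  rintro x ⟨y, hy, hyF, hxy⟩
  refine le_antisymm (Metric.infDist_le_infDist_of_subset (hF.image_subset i)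
    (hF.2.1.image _)) ?_
  refine (Metric.infDist_le_dist_of_mem hy).trans ((Metric.le_infDist hF.2.1).2 fun z hz => ?_)
  rcases eq_or_ne z y with rfl | hne
  · exact le_rfl
  · exact (hxy z hz hne).le

lemma scaledVolume_image_map (hP : S.ProjectionCondition F O) (hF : S.IsAttractor F)
    (i : Fin N) {ε : ℝ} (hε : 0 < ε) :
    scaledVolume α F (S.map i '' O) ε
      = S.ratio i ^ α * scaledVolume α F O (ε / S.ratio i) := by
  rw [← scaledVolume_image (S.ratio_pos i) (S.dist_map i) hF.2.1 hε, scaledVolume, scaledVolume]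
  congr 2
  ext x
  refine and_congr_left fun hx => ?_
  rw [mem_cthickening_iff_infDist hF.2.1 hε.le,
    mem_cthickening_iff_infDist (hF.2.1.image _) hε.le, hP.infDist_eq hF hx]

/-- The renewal equation of the parallel volume inside the feasible open set. -/
lemma scaledVolume_renewal (hP : S.ProjectionCondition F O) (hF : S.IsAttractor F)
    (hO : S.IsFeasible O) {ε : ℝ} (hε : 0 < ε) :
    scaledVolume α F O ε = ∑ i, S.ratio i ^ α * scaledVolume α F O (ε / S.ratio i)
      + scaledVolume α F (S.Gamma O) ε := by
  have hopen : ∀ i, IsOpen (S.map i '' O) := fun i =>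
    isOpen_image_similarity (S.ratio_pos i) (S.dist_map i) hO.1
  have hU : MeasurableSet (S.union O) := (isOpen_iUnion hopen).measurableSet
  have hsub : S.union O ⊆ O := iUnion_subset hO.2.2.1
  simp_rw [← scaledVolume_image_map hP hF _ hε, scaledVolume, ← Finset.mul_sum, ← mul_add]
  congr 1
  rw [← measureReal_inter_add_sdiff hU (volume_cthickening_inter_ne_top hF.1 ε), inter_assoc,
    inter_eq_self_of_subset_right hsub, Gamma, inter_sdiff_assoc]
  congr 1
  rw [union, inter_iUnion, measureReal_iUnion_fintype (h' := fun i =>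
    volume_cthickening_inter_ne_top hF.1 ε)]
  · intro i j hij
    refine Disjoint.mono inter_subset_right inter_subset_right ?_
    exact disjoint_iff_inter_eq_empty.2 (hO.2.2.2 i j hij)
  · intro i
    exact Metric.isClosed_cthickening.measurableSet.inter (hopen i).measurableSet

lemma scaledVolume_univ_le (hF : S.IsAttractor F) {ε : ℝ} (hε : 0 < ε) :
    scaledVolume α F univ ε
      ≤ ∑ i, S.ratio i ^ α * scaledVolume α F univ (ε / S.ratio i) := by
  have h := scaledVolume_iUnion_le (α := α)
    (fun i => isCompact_image (S.ratio_pos i) (S.dist_map i) hF.1) univ hε.le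
  have hFU : F = ⋃ i, S.map i '' F := hF.2.2
  rw [← hFU] at h
  refine h.trans_eq (Finset.sum_congr rfl fun i _ => ?_)
  rw [← scaledVolume_image (S.ratio_pos i) (S.dist_map i) hF.2.1 hε,
    image_univ_of_surjective (similarity_surjective (S.ratio_pos i) (S.dist_map i))]

/-! ### Cylinders, and the parallel volume outside the feasible open set -/

/-- The maps `S_{w_1} ∘ ⋯ ∘ S_{w_n}` of the system, with their scaling ratios. -/
inductive IsCylinderMap (S : SelfSimilarSystem d N) :
    (EuclideanSpace ℝ (Fin d) → EuclideanSpace ℝ (Fin d)) → ℝ → Prop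
  | id : IsCylinderMap S (fun x => x) 1
  | comp {T : EuclideanSpace ℝ (Fin d) → EuclideanSpace ℝ (Fin d)} {ρ : ℝ} (i : Fin N)
      (h : IsCylinderMap S T ρ) : IsCylinderMap S (fun x => T (S.map i x)) (ρ * S.ratio i)

namespace IsCylinderMap

variable {T : EuclideanSpace ℝ (Fin d) → EuclideanSpace ℝ (Fin d)} {ρ : ℝ}

lemma pos (h : S.IsCylinderMap T ρ) : 0 < ρ := by
  induction h with
  | id => exact one_pos
  | comp i _ ih => exact mul_pos ih (S.ratio_pos i)

lemma le_one (h : S.IsCylinderMap T ρ) : ρ ≤ 1 := by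
  induction h with
  | id => exact le_rfl
  | comp i h ih => exact mul_le_one₀ ih (S.ratio_pos i).le (S.ratio_lt_one i).le

lemma dist_map (h : S.IsCylinderMap T ρ) (x y : EuclideanSpace ℝ (Fin d)) :
    dist (T x) (T y) = ρ * dist x y := by
  induction h generalizing x y with
  | id => exact (one_mul _).symm
  | comp i _ ih => rw [ih, S.dist_map, mul_assoc]

lemma image_subset (h : S.IsCylinderMap T ρ) (hO : ∀ i, S.map i '' O ⊆ O) : T '' O ⊆ O := by
  induction h with
  | id => simp
  | @comp T ρ i _ ih =>
    rintro _ ⟨x, hx, rfl⟩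
    exact ih ⟨_, hO i ⟨x, hx, rfl⟩, rfl⟩

end IsCylinderMap

/-- Every point of the attractor lies in arbitrarily small cylinders. -/
lemma exists_isCylinderMap_mem (hF : S.IsAttractor F) {R : ℝ}
    (hRr : ∀ i, S.ratio i ≤ R) {x : EuclideanSpace ℝ (Fin d)} (hx : x ∈ F) (n : ℕ) :
    ∃ T ρ, S.IsCylinderMap T ρ ∧ ρ ≤ R ^ n ∧ x ∈ T '' F := by
  induction n with
  | zero => exact ⟨_, _, .id, by simp, by simpa using hx⟩
  | succ n ih =>
    obtain ⟨T, ρ, h, hρ, y, hy, rfl⟩ := ih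
    rw [hF.2.2] at hy
    obtain ⟨i, z, hz, rfl⟩ := mem_iUnion.1 hy
    refine ⟨_, _, h.comp i, ?_, z, hz, rfl⟩
    rw [pow_succ]
    exact mul_le_mul hρ (hRr i) (S.ratio_pos i).le (h.pos.le.trans hρ)

/-- For a strong feasible open set some cylinder lies in `O` together with a neighbourhood. -/
lemma exists_isCylinderMap_cthickening_subset (hN : 2 ≤ N) (hF : S.IsAttractor F)
    (hO : S.IsStrongFeasible F O) :
    ∃ T ρ, S.IsCylinderMap T ρ ∧ ∃ δ > 0, ∀ ε < δ, Metric.cthickening ε (T '' F) ⊆ O := by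
  obtain ⟨R, hR0, hR1, hR⟩ := S.exists_ratio_le hN
  obtain ⟨x, hxO, hxF⟩ := hO.2
  obtain ⟨η, hη, hball⟩ := Metric.isOpen_iff.1 hO.1.1 x hxO
  obtain ⟨n, hn⟩ := exists_pow_lt_of_lt_one (y := R) (x := η / 2 / (Metric.diam F + 1))
    (by have := Metric.diam_nonneg (s := F); positivity) hR1
  obtain ⟨T, ρ, h, hρ, y, hy, rfl⟩ := exists_isCylinderMap_mem hF hR hxF n
  refine ⟨T, ρ, h, η / 2, by positivity, fun ε hε => ?_⟩
  have hdiam : T '' F ⊆ Metric.ball (T y) (η / 2) := by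
    rintro _ ⟨z, hz, rfl⟩
    rw [Metric.mem_ball, h.dist_map]
    have h1 := Metric.dist_le_diam_of_mem hF.1.isBounded hz hy
    have h2 : 0 ≤ dist z y := dist_nonneg
    have h3 : ρ * dist z y ≤ R ^ n * (Metric.diam F + 1) := by gcongr; linarith
    have h4 := (lt_div_iff₀ (by positivity)).1 hn
    linarith
  refine (Metric.cthickening_subset_of_subset ε hdiam).trans ?_
  refine (Metric.cthickening_subset_thickening' (by positivity) hε _).trans ?_
  refine Subset.trans (fun z hz => ?_) hball
  obtain ⟨w, hw, hzw⟩ := Metric.mem_thickening_iff.1 hz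
  have := dist_triangle z w (T y)
  rw [Metric.mem_ball] at hw ⊢
  linarith

/-- If the normalised volume of `F_ε` outside `O` is at most `K`, then up to the contribution of
one cylinder of ratio `ρ` it is at most `K * (1 - ρ ^ α)`. -/
lemma IsCylinderMap.eventually_scaledVolume_compl_le {T} {ρ : ℝ} (hF : S.IsAttractor F)
    (hO : S.IsFeasible O) (hsum : ∑ i, S.ratio i ^ α = 1) {K : ℝ}
    (hK : ∀ᶠ ε in 𝓝[>] 0, scaledVolume α F Oᶜ ε ≤ K) (h : S.IsCylinderMap T ρ) :
    ∀ᶠ ε in 𝓝[>] 0,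
      scaledVolume α F Oᶜ ε ≤ K * (1 - ρ ^ α) + scaledVolume α (T '' F) Oᶜ ε := by
  induction h with
  | id => simp
  | @comp T ρ i h ih =>
    -- every cylinder of ratio `σ` contributes at most `K * σ ^ α`
    have hcyl : ∀ j, ∀ᶠ ε in 𝓝[>] (0 : ℝ),
        scaledVolume α ((fun x => T (S.map j x)) '' F) Oᶜ ε ≤ (ρ * S.ratio j) ^ α * K := by
      intro j
      have hj := h.comp j
      filter_upwards [(tendsto_div_nhdsGT_zero hj.pos).eventually hK, self_mem_nhdsWithin]
        with ε hε hε0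
      have hε0 : 0 < ε := hε0
      refine le_trans ?_ (mul_le_mul_of_nonneg_left hε (Real.rpow_nonneg hj.pos.le _))
      rw [← scaledVolume_image hj.pos hj.dist_map hF.2.1 hε0]
      refine scaledVolume_mono (isCompact_image hj.pos hj.dist_map hF.1) hε0.le ?_
      rw [image_compl_eq ⟨similarity_injective hj.pos hj.dist_map,
        similarity_surjective hj.pos hj.dist_map⟩]
      exact compl_subset_compl.2 (hj.image_subset hO.2.2.1)
    filter_upwards [ih, eventually_all.2 hcyl, self_mem_nhdsWithin] with ε h1 h2 hε0
    have hε0 : 0 < ε := hε0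
    have h3 := scaledVolume_iUnion_le (α := α) (fun j => isCompact_image (h.comp j).pos
      (h.comp j).dist_map hF.1) Oᶜ hε0.le
    have hU : ⋃ j, (fun x => T (S.map j x)) '' F = T '' F := by
      conv_rhs => rw [hF.2.2, union, image_iUnion]
      simp only [image_image]
    rw [hU] at h3
    have h4 : ∑ j ∈ Finset.univ.erase i,
        scaledVolume α ((fun x => T (S.map j x)) '' F) Oᶜ ε
        ≤ ∑ j ∈ Finset.univ.erase i, (ρ * S.ratio j) ^ α * K :=
      Finset.sum_le_sum fun j _ => h2 j
    have h5 := Finset.add_sum_erase Finset.univ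
      (fun j => scaledVolume α ((fun x => T (S.map j x)) '' F) Oᶜ ε) (Finset.mem_univ i)
    have h6 := Finset.add_sum_erase Finset.univ
      (fun j => (ρ * S.ratio j) ^ α * K) (Finset.mem_univ i)
    have h7 : ∑ j, (ρ * S.ratio j) ^ α * K = ρ ^ α * K := by
      simp_rw [Real.mul_rpow h.pos.le (S.ratio_pos _).le]
      rw [← Finset.sum_mul, ← Finset.mul_sum, hsum, mul_one]
    linarith

lemma tendsto_scaledVolume_compl (hN : 2 ≤ N) (hF : S.IsAttractor F)
    (hO : S.IsStrongFeasible F O) (hsum : ∑ i, S.ratio i ^ α = 1)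
    (hα : 0 ≤ α) {K : ℝ} (hK : ∀ᶠ ε in 𝓝[>] 0, scaledVolume α F Oᶜ ε ≤ K) :
    Tendsto (scaledVolume α F Oᶜ) (𝓝[>] 0) (𝓝 0) := by
  obtain ⟨T, ρ, h, δ, hδ, hT⟩ := exists_isCylinderMap_cthickening_subset hN hF hO
  have hρ1 : ρ ^ α ≤ 1 := Real.rpow_le_one h.pos.le h.le_one hα
  have hρ0 : 0 < ρ ^ α := Real.rpow_pos_of_pos h.pos α
  have hstep : ∀ n : ℕ, ∀ᶠ ε in 𝓝[>] 0, scaledVolume α F Oᶜ ε ≤ K * (1 - ρ ^ α) ^ n := by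
    intro n
    induction n with
    | zero => simpa using hK
    | succ n ih =>
      filter_upwards [h.eventually_scaledVolume_compl_le hF hO.1 hsum ih,
        Ioo_mem_nhdsGT hδ] with ε h1 h2
      have h3 : scaledVolume α (T '' F) Oᶜ ε = 0 := by
        rw [scaledVolume, ← sdiff_eq, sdiff_eq_empty.2 (hT ε h2.2), measureReal_empty, mul_zero]
      rw [h3, add_zero] at h1
      rwa [pow_succ, ← mul_assoc]
  refine tendsto_order.2 ⟨fun a ha => ?_, fun a ha => ?_⟩
  · filter_upwards [self_mem_nhdsWithin] with ε hε
    exact ha.trans_le (scaledVolume_nonneg (le_of_lt hε))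
  · have hlim : Tendsto (fun n : ℕ => K * (1 - ρ ^ α) ^ n) atTop (𝓝 (K * 0)) :=
      (tendsto_pow_atTop_nhds_zero_of_lt_one (by linarith) (by linarith)).const_mul K
    rw [mul_zero] at hlim
    obtain ⟨n, hn⟩ := (hlim.eventually (gt_mem_nhds ha)).exists
    filter_upwards [hstep n] with ε hε using hε.trans_lt hn

/-! ### The Moran equation -/

lemma scaledVolume_pos (hO : S.IsStrongFeasible F O) (hF : S.IsAttractor F) {ε : ℝ}
    (hε : 0 < ε) : 0 < scaledVolume α F O ε := by
  refine mul_pos (Real.rpow_pos_of_pos hε _) ?_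
  obtain ⟨x, hxO, hxF⟩ := hO.2
  have hpos : 0 < volume (Metric.thickening ε F ∩ O) :=
    (Metric.isOpen_thickening.inter hO.1.1).measure_pos _
      ⟨x, Metric.self_subset_thickening hε F hxF, hxO⟩
  refine ENNReal.toReal_pos ?_ (volume_cthickening_inter_ne_top hF.1 ε)
  exact (hpos.trans_le (measure_mono (inter_subset_inter_left _
    (Metric.thickening_subset_cthickening ε F)))).ne'

/-- If `F` has positive finite `α`-dimensional Minkowski content, then `α` solves the Moran
equation. The union bound for the parallel volume gives `1 ≤ ∑ i, r_i ^ α`; the opposite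
inequality holds since the parallel volume inside `O` is superadditive and not too small. -/
lemma sum_ratio_rpow_eq_one (hN : 2 ≤ N) (hP : S.ProjectionCondition F O)
    (hF : S.IsAttractor F) (hO : S.IsStrongFeasible F O) (hα : α ≤ d) {c : ℝ} (hc : 0 < c)
    (hlim : Tendsto (scaledVolume α F univ) (𝓝[>] 0) (𝓝 c)) :
    ∑ i, S.ratio i ^ α = 1 := by
  have hp : ∀ i, 0 < S.ratio i ^ α := fun i => Real.rpow_pos_of_pos (S.ratio_pos i) α
  apply le_antisymm
  · have hsuper : ∀ ε > 0, ∑ i, S.ratio i ^ α * scaledVolume α F O (ε / S.ratio i)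
        ≤ scaledVolume α F O ε := by
      intro ε hε
      rw [scaledVolume_renewal hP hF hO.1 hε]
      exact le_add_of_nonneg_right (scaledVolume_nonneg hε.le)
    by_contra! hgt
    set s := ∑ i, S.ratio i ^ α
    obtain ⟨R, hR0, hR1, hR⟩ := S.exists_ratio_le hN
    obtain ⟨q, hq0, hq⟩ := S.exists_le_ratio hN
    set m := volume.real (Metric.cthickening q F ∩ O)
    have hm : 0 < m :=
      (mul_pos_iff_of_pos_left (Real.rpow_pos_of_pos hq0 (α - d))).1 (scaledVolume_pos hO hF hq0)
    -- on `[q, 1]` the normalised volume is at least `m`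
    have hbase : ∀ ε, q ≤ ε → ε ≤ 1 → m ≤ scaledVolume α F O ε := by
      intro ε h1 h2
      have h3 : m ≤ volume.real (Metric.cthickening ε F ∩ O) :=
        measureReal_mono (inter_subset_inter_left _ (Metric.cthickening_mono h1 F))
          (volume_cthickening_inter_ne_top hF.1 ε)
      have h4 : 1 ≤ ε ^ (α - (d : ℝ)) :=
        Real.one_le_rpow_of_pos_of_le_one_of_nonpos (hq0.trans_le h1) h2 (by linarith)
      calc m ≤ 1 * volume.real (Metric.cthickening ε F ∩ O) := by linarith
        _ ≤ _ := mul_le_mul_of_nonneg_right h4 measureReal_nonneg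
    -- the superadditivity propagates lower bounds to smaller `ε`
    have hprop : ∀ {b K : ℝ}, (∀ ε, 0 < ε → ε ≤ b → K ≤ scaledVolume α F O ε) →
        ∀ ε, 0 < ε → ε ≤ q * b → s * K ≤ scaledVolume α F O ε := by
      intro b K h ε hε hεb
      refine le_trans ?_ (hsuper ε hε)
      rw [Finset.sum_mul]
      refine Finset.sum_le_sum fun i _ => mul_le_mul_of_nonneg_left (h _ ?_ ?_) (hp i).le
      · exact div_pos hε (S.ratio_pos i)
      · have hb : 0 < b := (mul_pos_iff_of_pos_left hq0).1 (hε.trans_le hεb)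
        rw [div_le_iff₀' (S.ratio_pos i)]
        exact hεb.trans (mul_le_mul_of_nonneg_right (hq i) hb.le)
    have hlow : ∀ n : ℕ, ∀ ε, 0 < ε → q * R ^ n ≤ ε → ε ≤ 1 → m ≤ scaledVolume α F O ε := by
      intro n
      induction n with
      | zero => intro ε _ h1 h2; exact hbase ε (by simpa using h1) h2
      | succ n ih =>
        intro ε hε h1 h2
        rcases le_or_gt q ε with h | h
        · exact hbase ε h h2
        · have h3 : ∑ i, S.ratio i ^ α * m ≤ scaledVolume α F O ε := by
            refine le_trans (Finset.sum_le_sum fun i _ => mul_le_mul_of_nonneg_left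
              (ih _ (div_pos hε (S.ratio_pos i)) ?_ ?_) (hp i).le) (hsuper ε hε)
            · rw [le_div_iff₀ (S.ratio_pos i)]
              refine le_trans ?_ h1
              rw [pow_succ, ← mul_assoc]
              exact mul_le_mul_of_nonneg_left (hR i) (by positivity)
            · rw [div_le_one (S.ratio_pos i)]
              exact h.le.trans (hq i)
          rw [← Finset.sum_mul] at h3
          nlinarith
    have hlow' : ∀ ε, 0 < ε → ε ≤ 1 → m ≤ scaledVolume α F O ε := by
      intro ε hε h1
      obtain ⟨n, hn⟩ := exists_pow_lt_of_lt_one (div_pos hε hq0) hR1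
      exact hlow n ε hε (by rw [lt_div_iff₀' hq0] at hn; exact hn.le) h1
    have hgrow : ∀ n : ℕ, ∀ ε, 0 < ε → ε ≤ q ^ n → s ^ n * m ≤ scaledVolume α F O ε := by
      intro n
      induction n with
      | zero => simpa using hlow'
      | succ n ih =>
        intro ε hε h
        have := hprop ih ε hε (by rwa [pow_succ'] at h)
        rwa [pow_succ', mul_assoc]
    obtain ⟨n, hn⟩ := pow_unbounded_of_one_lt ((c + 1) / m) hgt
    rw [div_lt_iff₀ hm] at hn
    obtain ⟨ε, h1, h2, h3⟩ := ((hlim.eventually (gt_mem_nhds (lt_add_one c))).and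
      (Ioo_mem_nhdsGT (pow_pos hq0 n))).exists
    have h4 := hgrow n ε h2 h3.le
    have h5 := scaledVolume_mono (α := α) hF.1 h2.le (subset_univ O)
    linarith
  · have h1 : Tendsto (fun ε => ∑ i, S.ratio i ^ α * scaledVolume α F univ (ε / S.ratio i))
        (𝓝[>] 0) (𝓝 (∑ i, S.ratio i ^ α * c)) :=
      tendsto_finsetSum _ fun i _ =>
        (hlim.comp (tendsto_div_nhdsGT_zero (S.ratio_pos i))).const_mul _
    have h2 : c ≤ ∑ i, S.ratio i ^ α * c := by
      refine le_of_tendsto_of_tendsto hlim h1 ?_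
      filter_upwards [self_mem_nhdsWithin] with ε hε using scaledVolume_univ_le hF hε
    rw [← Finset.sum_mul] at h2
    exact (le_mul_iff_one_le_left hc).1 h2

lemma tendsto_scaledVolume_feasible (hN : 2 ≤ N) (hP : S.ProjectionCondition F O)
    (hF : S.IsAttractor F) (hO : S.IsStrongFeasible F O) (hα0 : 0 ≤ α) (hα : α ≤ d) {c : ℝ}
    (hc : 0 < c) (hlim : Tendsto (scaledVolume α F univ) (𝓝[>] 0) (𝓝 c)) :
    Tendsto (scaledVolume α F O) (𝓝[>] 0) (𝓝 c) := by
  have hK : ∀ᶠ ε in 𝓝[>] 0, scaledVolume α F Oᶜ ε ≤ c + 1 := by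
    filter_upwards [hlim.eventually (gt_mem_nhds (lt_add_one c)), self_mem_nhdsWithin]
      with ε h1 h2
    exact (scaledVolume_mono hF.1 (le_of_lt h2) (subset_univ _)).trans h1.le
  have h := hlim.sub (tendsto_scaledVolume_compl hN hF hO
    (sum_ratio_rpow_eq_one hN hP hF hO hα hc hlim) hα0 hK)
  rw [sub_zero] at h
  refine h.congr fun ε => ?_
  rw [← scaledVolume_add_compl hF.1 hO.1.1.measurableSet, add_sub_cancel_right]

end SelfSimilarSystem

namespace SelfSimilarSystem

variable {d N : ℕ} {S : SelfSimilarSystem d N} {F O : Set (EuclideanSpace ℝ (Fin d))} {α : ℝ}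

/-- In a lattice system the base may be taken in `(0, 1)`, with positive exponents. -/
lemma IsLattice.exists_pow (hN : 2 ≤ N) (h : S.IsLattice) :
    ∃ r, 0 < r ∧ r < 1 ∧ ∃ k : Fin N → ℕ, ∀ i, 1 ≤ k i ∧ S.ratio i = r ^ k i := by
  have key : ∀ r : ℝ, 0 < r → r < 1 → (∀ i, ∃ k : ℤ, S.ratio i = r ^ k) →
      ∃ k : Fin N → ℕ, ∀ i, 1 ≤ k i ∧ S.ratio i = r ^ k i := by
    intro r h0 h1 hk
    choose k hk using hk
    have hpos : ∀ i, 0 < k i := by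
      intro i
      by_contra! hle
      have h2 : 1 ≤ r ^ k i := one_le_zpow_of_nonpos₀ h0 h1.le hle
      rw [← hk] at h2
      exact h2.not_gt (S.ratio_lt_one i)
    refine ⟨fun i => (k i).toNat, fun i => ⟨by
      have := hpos i
      dsimp only
      omega, ?_⟩⟩
    rw [hk, ← zpow_natCast, Int.toNat_of_nonneg (hpos i).le]
  obtain ⟨r, hr, hk⟩ := h
  rcases lt_trichotomy r 1 with h1 | rfl | h1
  · exact ⟨r, hr, h1, key r hr h1 hk⟩
  · obtain ⟨k, hk⟩ := hk ⟨0, by omega⟩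
    have := S.ratio_lt_one ⟨0, by omega⟩
    rw [hk, one_zpow] at this
    exact absurd this (lt_irrefl _)
  · refine ⟨r⁻¹, inv_pos.2 hr, inv_lt_one_of_one_lt₀ h1, key _ (inv_pos.2 hr)
      (inv_lt_one_of_one_lt₀ h1) fun i => ?_⟩
    obtain ⟨k, hk⟩ := hk i
    exact ⟨-k, by rw [hk, inv_zpow', neg_neg]⟩

/-! ### Boundedness of the feasible open set -/

/-- Blowing up by `S_i⁻¹`: a ball in `O` which is farther than `g` from `F` avoids `Γ(O)`, hence
lies in one of the disjoint open sets `S_i(O)`, and its preimage is a ball of the same kind. -/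
lemma exists_blowup (hP : S.ProjectionCondition F O) (hF : S.IsAttractor F)
    (hO : S.IsFeasible O) {g : ℝ}
    (hg : ∀ x ∈ S.Gamma O, Metric.infDist x F ≤ g) {y : EuclideanSpace ℝ (Fin d)} {ρ : ℝ}
    (hρ : 0 < ρ) (hy : Metric.ball y ρ ⊆ {x ∈ O | g < Metric.infDist x F}) :
    ∃ i z, Metric.ball z (ρ / S.ratio i) ⊆ {x ∈ O | g < Metric.infDist x F} ∧
      Metric.infDist z F = Metric.infDist y F / S.ratio i := by
  have hopen : ∀ i, IsOpen (S.map i '' O) := fun i =>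
    isOpen_image_similarity (S.ratio_pos i) (S.dist_map i) hO.1
  have hcov : Metric.ball y ρ ⊆ S.union O := by
    intro x hx
    by_contra hxU
    exact (hg x ⟨(hy hx).1, hxU⟩).not_gt (hy hx).2
  obtain ⟨i, z, hz, rfl⟩ := mem_iUnion.1 (hcov (Metric.mem_ball_self hρ))
  have hri := S.ratio_pos i
  have hball : Metric.ball (S.map i z) ρ ⊆ S.map i '' O := by
    refine (convex_ball _ _).isPreconnected.subset_left_of_subset_union (hopen i)
      (isOpen_iUnion fun j : {j // i ≠ j} => hopen j) ?_ ?_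
      ⟨_, Metric.mem_ball_self hρ, z, hz, rfl⟩
    · exact disjoint_iUnion_right.2 fun j =>
        disjoint_iff_inter_eq_empty.2 (hO.2.2.2 i j j.2)
    · intro x hx
      obtain ⟨j, hj⟩ := mem_iUnion.1 (hcov hx)
      rcases eq_or_ne i j with rfl | hij
      · exact Or.inl hj
      · exact Or.inr (mem_iUnion.2 ⟨⟨j, hij⟩, hj⟩)
  have hdist : ∀ w ∈ O, Metric.infDist w F = Metric.infDist (S.map i w) F / S.ratio i := by
    intro w hw
    rw [hP.infDist_eq hF ⟨w, hw, rfl⟩, infDist_image_similarity hri (S.dist_map i) hF.2.1,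
      mul_div_cancel_left₀ _ hri.ne']
  refine ⟨i, z, fun w hw => ?_, hdist z hz⟩
  have hw' : S.map i w ∈ Metric.ball (S.map i z) ρ := by
    rw [Metric.mem_ball, S.dist_map, ← lt_div_iff₀' hri]
    exact hw
  have hwO : w ∈ O :=
    (similarity_injective hri (S.dist_map i)).mem_set_image.1 (hball hw')
  refine ⟨hwO, ?_⟩
  rw [hdist w hwO]
  exact (hy hw').2.trans_le (le_div_self Metric.infDist_nonneg hri (S.ratio_lt_one i).le)

/-- If the normalised parallel volumes inside `O` are bounded, then the distances `d(x, F)`,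
`x ∈ O`, have the same bound as those of the points of `Γ(O)`. Otherwise repeated blow-up yields
arbitrarily large balls in `O`, of radius proportional to their distance from `F`, and these
occupy too much volume. -/
lemma infDist_le_of_scaledVolume_le (hN : 2 ≤ N) (hP : S.ProjectionCondition F O)
    (hF : S.IsAttractor F) (hO : S.IsFeasible O) (hα : 0 < α) {B : ℝ}
    (hB : ∀ ε > 0, scaledVolume α F O ε ≤ B) {g : ℝ} (hg0 : 0 ≤ g)
    (hg : ∀ x ∈ S.Gamma O, Metric.infDist x F ≤ g) {x : EuclideanSpace ℝ (Fin d)}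
    (hx : x ∈ O) : Metric.infDist x F ≤ g := by
  by_contra! hlt
  have hUo : IsOpen {x ∈ O | g < Metric.infDist x F} :=
    hO.1.inter (isOpen_lt continuous_const (Metric.continuous_infDist_pt _))
  obtain ⟨ρ, hρ, hball⟩ := Metric.isOpen_iff.1 hUo x ⟨hx, hlt⟩
  obtain ⟨R, hR0, hR1, hR⟩ := S.exists_ratio_le hN
  set D := Metric.infDist x F
  have hD : 0 < D := hg0.trans_lt hlt
  set θ := ρ / D
  have hθ : 0 < θ := by positivity
  have hseq : ∀ n : ℕ, ∃ y, D / R ^ n ≤ Metric.infDist y F ∧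
      Metric.ball y (θ * Metric.infDist y F) ⊆ {x ∈ O | g < Metric.infDist x F} := by
    intro n
    induction n with
    | zero =>
      refine ⟨x, by simp [D], ?_⟩
      have : θ * Metric.infDist x F = ρ := div_mul_cancel₀ _ hD.ne'
      rwa [this]
    | succ n ih =>
      obtain ⟨y, h1, h2⟩ := ih
      have hy : 0 < Metric.infDist y F := lt_of_lt_of_le (by positivity) h1
      obtain ⟨i, z, h3, h4⟩ := exists_blowup hP hF hO hg (by positivity) h2
      refine ⟨z, ?_, ?_⟩
      · rw [h4, pow_succ, ← div_div]
        exact div_le_div₀ hy.le h1 (S.ratio_pos i) (hR i)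
      · rwa [h4, ← mul_div_assoc]
  set ω := volume.real (Metric.ball (0 : EuclideanSpace ℝ (Fin d)) 1)
  have hω : 0 < ω := ENNReal.toReal_pos
    (Metric.isOpen_ball.measure_pos _ (Metric.nonempty_ball.2 one_pos)).ne'
    measure_ball_lt_top.ne
  have hlarge : ∀ᶠ t : ℝ in atTop, B / ((θ / (1 + θ)) ^ d * ω) < t ^ α :=
    (tendsto_rpow_atTop hα).eventually_gt_atTop _
  obtain ⟨X, hX⟩ := eventually_atTop.1 hlarge
  obtain ⟨n, hn⟩ : ∃ n : ℕ, |X| ≤ D / R ^ n := by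
    obtain ⟨n, hn⟩ := exists_pow_lt_of_lt_one (show 0 < D / (|X| + 1) by positivity) hR1
    refine ⟨n, ?_⟩
    rw [lt_div_iff₀ (by positivity)] at hn
    rw [le_div_iff₀ (by positivity)]
    nlinarith [pow_pos hR0 n]
  obtain ⟨y, h1, h2⟩ := hseq n
  set t := Metric.infDist y F
  have ht : 0 < t := lt_of_lt_of_le (by positivity) h1
  set ε := (1 + θ) * t
  have hε : 0 < ε := by positivity
  have hXε : X ≤ ε := by
    have : X ≤ t := (le_abs_self X).trans (hn.trans h1)
    nlinarith
  have hsub : Metric.ball y (θ * t) ⊆ Metric.cthickening ε F ∩ O := by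
    intro w hw
    refine ⟨?_, (h2 hw).1⟩
    rw [mem_cthickening_iff_infDist hF.2.1 hε.le]
    have h3 := Metric.infDist_le_infDist_add_dist (s := F) (x := w) (y := y)
    have h4 := Metric.mem_ball.1 hw
    have h5 : ε = t + θ * t := by ring
    linarith
  have hvol : volume.real (Metric.ball y (θ * t)) = (θ * t) ^ d * ω := by
    rw [measureReal_def, Measure.addHaar_ball_of_pos _ _ (by positivity), ENNReal.toReal_mul,
      finrank_euclideanSpace, Fintype.card_fin, ENNReal.toReal_ofReal (by positivity),
      ← measureReal_def]
  have hlow := measureReal_mono hsub (volume_cthickening_inter_ne_top hF.1 ε)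
  rw [hvol] at hlow
  have h6 : ε ^ (α - (d : ℝ)) * ((θ * t) ^ d * ω) ≤ B :=
    (mul_le_mul_of_nonneg_left hlow (by positivity)).trans (hB ε hε)
  have h7 : ε ^ (α - (d : ℝ)) * ((θ * t) ^ d * ω) = ε ^ α * ((θ / (1 + θ)) ^ d * ω) := by
    have h8 : θ * t = ε * (θ / (1 + θ)) := by
      simp only [ε]
      field_simp
    rw [h8, mul_pow, Real.rpow_sub hε, Real.rpow_natCast]
    field_simp
  have h9 := hX ε hXε
  rw [div_lt_iff₀ (by positivity)] at h9
  linarith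

lemma tendsto_scaledVolume_atTop (hF : S.IsAttractor F) (hα : α < d) {g : ℝ} (hg0 : 0 ≤ g)
    (hg : ∀ x ∈ O, Metric.infDist x F ≤ g) :
    Tendsto (scaledVolume α F O) atTop (𝓝 0) := by
  have h1 : Tendsto (fun ε : ℝ => ε ^ (α - (d : ℝ)) * volume.real O) atTop
      (𝓝 (0 * volume.real O)) := by
    have := tendsto_rpow_neg_atTop (y := (d : ℝ) - α) (by linarith)
    rw [neg_sub] at this
    exact this.mul_const _
  rw [zero_mul] at h1
  refine h1.congr' ?_
  filter_upwards [eventually_ge_atTop g] with ε hε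
  rw [scaledVolume, inter_eq_self_of_subset_right]
  intro x hx
  rw [mem_cthickening_iff_infDist hF.2.1 (hg0.trans hε)]
  exact (hg x hx).trans hε

end SelfSimilarSystem

/-! ### Renewal along geometric progressions -/

/-- A primitive of the renewal equation `f(t) = ∑ i, p_i f(t / r ^ k_i) + γ(t)` along the
geometric progressions of ratio `r`; see `renewalPrimitive_mul_sub`. -/
noncomputable def renewalPrimitive {ι : Type*} [Fintype ι] (p : ι → ℝ) (k : ι → ℕ) (r : ℝ)
    (f : ℝ → ℝ) (t : ℝ) : ℝ :=
  ∑ i, p i * ∑ j ∈ Finset.range (k i), f (t / r ^ (j + 1))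

section renewalPrimitive

variable {ι : Type*} [Fintype ι] {p : ι → ℝ} {k : ι → ℕ} {r : ℝ} {f : ℝ → ℝ}

lemma renewalPrimitive_mul_sub (hr : 0 < r) (hp : ∑ i, p i = 1) (t : ℝ) :
    renewalPrimitive p k r f (r * t) - renewalPrimitive p k r f t
      = f t - ∑ i, p i * f (t / r ^ k i) := by
  have h1 : ∀ j : ℕ, r * t / r ^ (j + 1) = t / r ^ j := by
    intro j
    rw [pow_succ', mul_div_mul_left _ _ hr.ne']
  have h2 : f t = ∑ i, p i * f t := by rw [← Finset.sum_mul, hp, one_mul]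
  rw [renewalPrimitive, renewalPrimitive, h2, ← Finset.sum_sub_distrib,
    ← Finset.sum_sub_distrib]
  refine Finset.sum_congr rfl fun i _ => ?_
  rw [← mul_sub, ← mul_sub, ← Finset.sum_sub_distrib]
  simp_rw [h1]
  rw [Finset.sum_range_sub' (fun j => f (t / r ^ j)), pow_zero, div_one]

lemma tendsto_renewalPrimitive {l : Filter ℝ} {c : ℝ} (hf : Tendsto f l (𝓝 c))
    (hl : ∀ j : ℕ, Tendsto (fun t => t / r ^ j) l l) :
    Tendsto (renewalPrimitive p k r f) l (𝓝 (∑ i, p i * (k i * c))) := by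
  refine tendsto_finsetSum _ fun i _ => Tendsto.const_mul _ ?_
  have h := tendsto_finsetSum (Finset.range (k i)) fun j _ => hf.comp (hl (j + 1))
  simpa using h

lemma le_renewalPrimitive (hr : 0 < r) (hp0 : ∀ i, 0 ≤ p i) (hp : ∑ i, p i = 1)
    (hk : ∀ i, 1 ≤ k i) (hf : ∀ t > 0, 0 ≤ f t) {t : ℝ} (ht : 0 < t) :
    f (t / r) ≤ renewalPrimitive p k r f t := by
  calc f (t / r) = ∑ i, p i * f (t / r) := by rw [← Finset.sum_mul, hp, one_mul]
    _ ≤ _ := by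
      refine Finset.sum_le_sum fun i _ => mul_le_mul_of_nonneg_left ?_ (hp0 i)
      have h := Finset.single_le_sum (f := fun j => f (t / r ^ (j + 1)))
        (s := Finset.range (k i)) (fun j _ => hf _ (by positivity))
        (Finset.mem_range.2 (hk i))
      simpa using h

end renewalPrimitive

/-- There is an interval `(1, x]` whose images under multiplication by powers of `r` avoid a given
finite family of points, in the sense that each point lies on a definite side of each image. -/
lemma exists_interval_avoiding_zpow_mul {ι : Type*} [Finite ι] {r : ℝ} (hr0 : 0 < r)
    (hr1 : r < 1) (a : ι → ℝ) :
    ∃ x > 1, ∀ i, ∀ n : ℤ, ∀ s ∈ Ioc 1 x, ∀ t ∈ Ioc 1 x, a i < r ^ n * s → a i < r ^ n * t := by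
  have key : ∀ i, ∀ᶠ x in 𝓝[>] (1 : ℝ), ∀ n : ℤ, ∀ s ∈ Ioc 1 x, ∀ t ∈ Ioc 1 x,
      a i < r ^ n * s → a i < r ^ n * t := by
    intro i
    rcases le_or_gt (a i) 0 with h | h
    · refine Eventually.of_forall fun x n s _ t ht _ => h.trans_lt ?_
      have := ht.1
      positivity
    · obtain ⟨m, hm1, hm2⟩ := exists_mem_Ico_zpow (inv_pos.2 h) ((one_lt_inv₀ hr0).2 hr1)
      -- `a i * r⁻¹ ^ (m + 1)` is the least number of the form `a i * r ^ n` above `1`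
      have hx : 1 < a i * r⁻¹ ^ (m + 1) := by
        rwa [inv_lt_iff_one_lt_mul₀' h] at hm2
      filter_upwards [Ioc_mem_nhdsGT hx] with x hx n s hs t ht hlt
      by_contra! hle
      have hrn : 0 < r ^ n := zpow_pos hr0 n
      have h1 : r ^ n < a i := by nlinarith [ht.1]
      have h2 : r⁻¹ ^ m < r⁻¹ ^ n := by
        rw [inv_zpow r n]
        exact hm1.trans_lt ((inv_lt_inv₀ h hrn).2 h1)
      have h3 : m + 1 ≤ n := (zpow_lt_zpow_iff_right₀ ((one_lt_inv₀ hr0).2 hr1)).1 h2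
      have h4 : r⁻¹ ^ (m + 1) ≤ r⁻¹ ^ n :=
        zpow_le_zpow_right₀ ((one_lt_inv₀ hr0).2 hr1).le h3
      have h5 : a i * r⁻¹ ^ n < s := by
        rwa [inv_zpow, ← div_eq_mul_inv, div_lt_iff₀' hrn]
      have h6 := mul_le_mul_of_nonneg_left h4 h.le
      linarith [hx.2, hs.2]
  obtain ⟨x, hx1, hx2⟩ := ((eventually_all.2 key).and self_mem_nhdsWithin).exists
  exact ⟨x, hx2, hx1⟩

/-! ### Pluriphase generators -/

open Polynomial in
/-- The coefficients of `∏ k, (X - q ^ (α - k))` define a difference operator which kills the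
functions `t ↦ t ^ (α - k)`, `0 ≤ k ≤ d`, on geometric progressions of ratio `q`, but no nonzero
constant when `α` is not an integer. -/
lemma exists_annihilator_rpow (d : ℕ) {α q : ℝ} (hα : ∀ n : ℤ, α ≠ n) (hq : 1 < q) :
    ∃ c : ℕ → ℝ, ∑ j ∈ Finset.range (d + 2), c j ≠ 0 ∧
      ∀ k : Fin (d + 1), ∀ t > 0,
        ∑ j ∈ Finset.range (d + 2), c j * (t * q ^ j) ^ (α - (k : ℕ)) = 0 := by
  have hq0 : 0 < q := one_pos.trans hq
  set P : ℝ[X] := ∏ k : Fin (d + 1), (X - C (q ^ (α - (k : ℕ)))) with hP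
  have hdeg : P.natDegree < d + 2 := by
    rw [hP, natDegree_prod_of_monic _ _ fun k _ => monic_X_sub_C _]
    simp
  refine ⟨P.coeff, ?_, fun k t ht => ?_⟩
  · have h := eval_eq_sum_range' hdeg 1
    simp only [one_pow, mul_one] at h
    rw [← h, hP, eval_prod, Finset.prod_ne_zero_iff]
    intro k _
    rw [eval_sub, eval_X, eval_C, sub_ne_zero]
    intro h1
    have h2 : α - (k : ℕ) = 0 := by
      by_contra hne
      exact hq.ne ((Real.rpow_left_inj zero_le_one hq0.le hne).1 (by rw [Real.one_rpow, h1]))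
    exact hα (k : ℕ) (by push_cast; linarith)
  · have h := eval_eq_sum_range' hdeg (q ^ (α - (k : ℕ)))
    have h0 : P.eval (q ^ (α - (k : ℕ))) = 0 := by
      rw [hP, eval_prod]
      exact Finset.prod_eq_zero (Finset.mem_univ k) (by simp)
    rw [h0] at h
    have h1 : ∀ j ∈ Finset.range (d + 2), P.coeff j * (t * q ^ j) ^ (α - (k : ℕ))
        = t ^ (α - (k : ℕ)) * (P.coeff j * (q ^ (α - (k : ℕ))) ^ j) := by
      intro j _
      rw [Real.mul_rpow ht.le (by positivity), ← Real.rpow_natCast q j, ← Real.rpow_mul hq0.le,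
        ← Real.rpow_natCast (q ^ _) j, ← Real.rpow_mul hq0.le, mul_comm (j : ℝ)]
      ring
    rw [Finset.sum_congr rfl h1, ← Finset.mul_sum, ← h, mul_zero]

namespace SelfSimilarSystem

variable {d N : ℕ} {S : SelfSimilarSystem d N} {F O : Set (EuclideanSpace ℝ (Fin d))} {α : ℝ}

/-- In the pluriphase case there is an interval `(1, x]` on each of whose images under
multiplication by a power of `r` the function `ε ↦ ε ^ (α - d) * λ_d(F_ε ∩ Γ)` is a single linear
combination of the powers `ε ^ (α - k)`. -/
lemma IsPluriphase.exists_interval (h : S.IsPluriphase F O) (α : ℝ) {r : ℝ} (hr0 : 0 < r)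
    (hr1 : r < 1) :
    ∃ x > 1, ∀ n : ℤ, ∃ κ : Fin (d + 1) → ℝ, ∀ t ∈ Ioc 1 x,
      scaledVolume α F (S.Gamma O) (r ^ n * t)
        = ∑ k, κ k * (r ^ n * t) ^ (α - ((k : ℕ) : ℝ)) := by
  obtain ⟨M, a, κ, -, ha0, -, -, hphase, hlarge⟩ := h
  obtain ⟨x, hx1, hx⟩ := exists_interval_avoiding_zpow_mul hr0 hr1 a
  refine ⟨x, hx1, fun n => ?_⟩
  have hrn : 0 < r ^ n := zpow_pos hr0 n
  have hxm : x ∈ Ioc 1 x := right_mem_Ioc.2 hx1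
  have hpow : ∀ t ∈ Ioc 1 x, ∀ k : Fin (d + 1), (r ^ n * t) ^ (α - (d : ℝ)) *
      (r ^ n * t) ^ (d - (k : ℕ)) = (r ^ n * t) ^ (α - ((k : ℕ) : ℝ)) := by
    intro t ht k
    have : 0 < r ^ n * t := mul_pos hrn (one_pos.trans ht.1)
    rw [← Real.rpow_natCast, ← Real.rpow_add this, Nat.cast_sub (Nat.lt_succ_iff.1 k.2)]
    congr 1
    ring
  rcases lt_or_ge (a (Fin.last M)) (r ^ n * x) with hlt | hge
  · -- beyond `g` only the power with `k = d` occurs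
    refine ⟨fun k => if k = Fin.last d then volume.real (S.Gamma O) else 0, fun t ht => ?_⟩
    rw [scaledVolume, hlarge _ (hx _ n x hxm t ht hlt)]
    simp [mul_comm]
  · obtain ⟨m, h1, h2⟩ : ∃ m : Fin M, a m.castSucc < r ^ n * x ∧ r ^ n * x ≤ a m.succ := by
      by_contra! hnone
      have hall : ∀ j, a j < r ^ n * x :=
        Fin.induction (by rw [ha0]; exact mul_pos hrn (one_pos.trans hx1)) hnone
      exact (hall _).not_ge hge
    refine ⟨κ m, fun t ht => ?_⟩
    rw [scaledVolume, hphase m _ ⟨hx _ n x hxm t ht h1,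
      (mul_le_mul_of_nonneg_left ht.2 hrn.le).trans h2⟩, Finset.mul_sum]
    refine Finset.sum_congr rfl fun k _ => ?_
    rw [← hpow t ht k]
    ring

end SelfSimilarSystem

/-- Let a difference operator that does not kill constants annihilate the increments of `Φ` along
the progressions `n ↦ r ^ n * t`. Then it takes the same value on all the functions
`t ↦ Φ (r ^ n * t)`, `n ∈ ℤ`; so if `Φ` tends to `L` at `0` and to `0` at `∞`, then `L = 0`. -/
lemma eq_zero_of_sum_increments_eq_zero {Φ : ℝ → ℝ} {r L : ℝ} (hr0 : 0 < r) (hr1 : r < 1)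
    (h0 : Tendsto Φ (𝓝[>] 0) (𝓝 L)) (htop : Tendsto Φ atTop (𝓝 0)) {s : Finset ℕ} {c t : ℕ → ℝ}
    (ht : ∀ j, 0 < t j) (hc : ∑ j ∈ s, c j ≠ 0)
    (hinc : ∀ n : ℤ, ∑ j ∈ s, c j * (Φ (r * (r ^ n * t j)) - Φ (r ^ n * t j)) = 0) : L = 0 := by
  set Λ : ℤ → ℝ := fun n => ∑ j ∈ s, c j * Φ (r ^ n * t j)
  have hstep : ∀ n, Λ (n + 1) = Λ n := by
    intro n
    rw [← sub_eq_zero, ← hinc n, ← Finset.sum_sub_distrib]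
    refine Finset.sum_congr rfl fun j _ => ?_
    rw [zpow_add_one₀ hr0.ne', mul_sub, ← mul_assoc r, mul_comm r]
  have hconst : ∀ n : ℕ, Λ n = Λ 0 ∧ Λ (-n) = Λ 0 := by
    intro n
    induction n with
    | zero => simp
    | succ n ih =>
      refine ⟨by rw [Nat.cast_succ, hstep, ih.1], ?_⟩
      rw [← hstep, ← ih.2]
      congr 1
      push_cast
      ring
  have hlim0 : Tendsto (fun n : ℕ => Λ n) atTop (𝓝 (∑ j ∈ s, c j * L)) := by
    refine tendsto_finsetSum _ fun j _ => (h0.comp ?_).const_mul _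
    refine tendsto_nhdsWithin_iff.2 ⟨?_, Eventually.of_forall fun n => ?_⟩
    · simpa using (tendsto_pow_atTop_nhds_zero_of_lt_one hr0.le hr1).mul_const (t j)
    · exact mul_pos (zpow_pos hr0 _) (ht j)
  have hlimtop : Tendsto (fun n : ℕ => Λ (-n)) atTop (𝓝 (∑ j ∈ s, c j * 0)) := by
    refine tendsto_finsetSum _ fun j _ => (htop.comp ?_).const_mul _
    have h := (tendsto_pow_atTop_atTop_of_one_lt ((one_lt_inv₀ hr0).2 hr1)).atTop_mul_const (ht j)
    refine h.congr fun n => ?_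
    simp
  have e1 := tendsto_nhds_unique hlim0 (tendsto_const_nhds.congr fun n => (hconst n).1.symm)
  have e2 := tendsto_nhds_unique hlimtop (tendsto_const_nhds.congr fun n => (hconst n).2.symm)
  rw [← e2, ← Finset.sum_mul] at e1
  simpa [hc] using e1

theorem theorem3p3 {d N : ℕ} (hN : 2 ≤ N) (S : SelfSimilarSystem d N)
    (hlat : S.IsLattice) (hOSC : S.OpenSetCondition)
    (F : Set (EuclideanSpace ℝ (Fin d))) (hF : S.IsAttractor F)
    (hD : ∀ n : ℤ, minkowskiDim F ≠ (n : ℝ))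
    (hO : ∃ O : Set (EuclideanSpace ℝ (Fin d)),
      S.IsStrongFeasible F O ∧ S.ProjectionCondition F O ∧ S.IsPluriphase F O) :
    ¬ IsMinkowskiMeasurable F := by
  rintro ⟨α, hα0, hαd, C, hC0, hCtop, hC⟩
  obtain ⟨O, hO, hP, hpl⟩ := hO
  rw [minkowskiDim_eq_of_hasMinkowskiContent hα0 hC0 hCtop hC] at hD
  have hα0' : 0 < α := hα0.lt_of_ne' (by simpa using hD 0)
  have hαd' : α < d := hαd.lt_of_ne (by simpa using hD d)
  have hc : 0 < C.toReal := ENNReal.toReal_pos hC0 hCtop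
  have hlim := tendsto_scaledVolume_of_hasMinkowskiContent hCtop hC
  have hsum := SelfSimilarSystem.sum_ratio_rpow_eq_one hN hP hF hO hαd hc hlim
  have hf0 := SelfSimilarSystem.tendsto_scaledVolume_feasible hN hP hF hO hα0 hαd hc hlim
  obtain ⟨r, hr0, hr1, k, hk⟩ := hlat.exists_pow hN
  set f := scaledVolume α F O
  set Φ := renewalPrimitive (fun i => S.ratio i ^ α) k r f
  have hp : ∀ i, 0 < S.ratio i ^ α := fun i => Real.rpow_pos_of_pos (S.ratio_pos i) α
  have hf : ∀ t > 0, 0 ≤ f t := fun t ht => scaledVolume_nonneg ht.le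
  have hinc : ∀ t > 0, Φ (r * t) - Φ t = scaledVolume α F (S.Gamma O) t := by
    intro t ht
    rw [renewalPrimitive_mul_sub hr0 hsum, sub_eq_iff_eq_add']
    simp_rw [← (hk _).2]
    exact SelfSimilarSystem.scaledVolume_renewal hP hF hO.1 ht
  set L := ∑ i, S.ratio i ^ α * (k i * C.toReal)
  have hL : 0 < L := by
    have : Nonempty (Fin N) := ⟨⟨0, by omega⟩⟩
    refine Finset.sum_pos (fun i _ => mul_pos (hp i) (mul_pos ?_ hc)) Finset.univ_nonempty
    exact_mod_cast (hk i).1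
  have hΦ0 : Tendsto Φ (𝓝[>] 0) (𝓝 L) :=
    tendsto_renewalPrimitive hf0 fun j => tendsto_div_nhdsGT_zero (pow_pos hr0 j)
  -- `Φ` increases along `t, r * t, r ^ 2 * t, …`, so it is bounded by its limit at `0`
  have hΦL : ∀ t > 0, Φ t ≤ L := by
    intro t ht
    have hmono : Monotone fun n : ℕ => Φ (r ^ n * t) := by
      refine monotone_nat_of_le_succ fun n => ?_
      have hpos : 0 < r ^ n * t := by positivity
      rw [pow_succ', mul_assoc, ← sub_nonneg, hinc _ hpos]
      exact scaledVolume_nonneg hpos.le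
    have hn : Tendsto (fun n : ℕ => r ^ n * t) atTop (𝓝[>] 0) := by
      refine tendsto_nhdsWithin_iff.2 ⟨?_, Eventually.of_forall fun n => ?_⟩
      · simpa using (tendsto_pow_atTop_nhds_zero_of_lt_one hr0.le hr1).mul_const t
      · exact mul_pos (pow_pos hr0 _) ht
    simpa using hmono.ge_of_tendsto (hΦ0.comp hn) 0
  have hfL : ∀ ε > 0, f ε ≤ L := by
    intro ε hε
    have hpos : 0 < r * ε := by positivity
    have h := le_renewalPrimitive (f := f) hr0 (fun i => (hp i).le) hsum (fun i => (hk i).1) hf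
      hpos
    rw [mul_div_cancel_left₀ _ hr0.ne'] at h
    exact h.trans (hΦL _ hpos)
  obtain ⟨g, hg0, hg⟩ : ∃ g, 0 ≤ g ∧ ∀ x ∈ S.Gamma O, Metric.infDist x F ≤ g := by
    obtain ⟨M, a, -, -, ha0, hmono, hlub, -⟩ := hpl
    refine ⟨_, ?_, fun x hx => hlub.1 (mem_image_of_mem _ hx)⟩
    rw [← ha0]
    exact hmono.monotone (Fin.zero_le _)
  have hftop : Tendsto f atTop (𝓝 0) :=
    SelfSimilarSystem.tendsto_scaledVolume_atTop hF hαd' hg0 fun x hx =>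
      SelfSimilarSystem.infDist_le_of_scaledVolume_le hN hP hF hO.1 hα0' hfL hg0 hg hx
  have hΦtop : Tendsto Φ atTop (𝓝 0) := by
    have h := tendsto_renewalPrimitive (p := fun i => S.ratio i ^ α) (k := k) (r := r) hftop
      fun j => tendsto_id.atTop_div_const (pow_pos hr0 j)
    simpa using h
  obtain ⟨x, hx1, hx⟩ := hpl.exists_interval α hr0 hr1
  -- the points `q, q ^ 2, …, q ^ (d + 2) = x` lie in `(1, x]`
  set q : ℝ := x ^ (((d + 2 : ℕ) : ℝ)⁻¹)
  have hq1 : 1 < q := Real.one_lt_rpow hx1 (by positivity)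
  have hqx : q ^ (d + 2) = x := Real.rpow_inv_natCast_pow (by linarith) (by omega)
  obtain ⟨c, hc1, hc0⟩ := exists_annihilator_rpow d hD hq1
  refine hL.ne' (eq_zero_of_sum_increments_eq_zero hr0 hr1 hΦ0 hΦtop
    (t := fun j => q * q ^ j) (fun j => by positivity) hc1 fun n => ?_)
  obtain ⟨κ, hκ⟩ := hx n
  have hrn : 0 < r ^ n := zpow_pos hr0 n
  have h1 : ∀ j ∈ Finset.range (d + 2),
      c j * (Φ (r * (r ^ n * (q * q ^ j))) - Φ (r ^ n * (q * q ^ j)))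
        = ∑ k, κ k * (c j * (r ^ n * q * q ^ j) ^ (α - ((k : Fin (d + 1)) : ℕ))) := by
    intro j hj
    have hmem : q * q ^ j ∈ Ioc 1 x := by
      rw [← pow_succ', ← hqx]
      exact ⟨one_lt_pow₀ hq1 (by omega),
        pow_le_pow_right₀ hq1.le (by have := Finset.mem_range.1 hj; omega)⟩
    rw [hinc _ (by positivity), hκ _ hmem, Finset.mul_sum]
    refine Finset.sum_congr rfl fun k _ => ?_
    rw [mul_assoc (r ^ n)]
    ring
  rw [Finset.sum_congr rfl h1, Finset.sum_comm]
  refine Finset.sum_eq_zero fun k _ => ?_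
  rw [← Finset.mul_sum, hc0 k _ (by positivity), mul_zero]
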